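/- Let $X$ be a zero-dimensional metric space (that is, the clopen subsets of $X$ form a base of its topology), and let $X'$ be the set of all non-isolated points of $X$. Let $C_k(X,2)$ be the group of all continuous functions from $X$ to the discrete group $2=\mathbb{Z}/2\mathbb{Z}$, with pointwise addition and the compact-open topology. Recall that a topological space $Y$ is a $k$-space if for every non-closed $A\subseteq Y$ there is a compact $K\subseteq Y$ such that $A\cap K$ is not closed in $K$. Then $C_k(X,2)$ is a $k$-space if and only if one of the following conditions holds: (a) $X=L\sqcup D$ is a topological sum of a separable locally compact space $L$ and a discrete space $D$; (b) $X$ is not locally compact, but $X'$ is compact. In case (a), $C_k(X,2)$ is topologically isomorphic to the product of a Polish abelian group and a compact (Hausdorff) abelian group. In case (b), $C_k(X,2)$ contains an open subgroup which is topologically isomorphic to the direct sum $\bigoplus_{n\in\mathbb{N}}2^{\kappa_n}$ with the box topology, for some sequence $(\kappa_n)_{n\in\mathbb{N}}$ of non-zero cardinals. Here $2^{\kappa_n}$ has the product topology, the direct sum consists of all $(g_n)_n\in\prod_n 2^{\kappa_n}$ with $g_n=0$ for all but finitely many $n$, and a base of its box topology is formed by the sets $\{(g_n)_n : g_n\in U_n\text{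 for all }n\}$ with $U_n$ open in $2^{\kappa_n}$. -/

import Mathlib

open Set Topology TopologicalSpace

universe u

/-- The algebraic direct sum of a sequence of abelian groups (finitely supported sequences), as a
type of its own, so that it can carry the box topology below. -/
def BoxDirectSum (G : ℕ → Type u) [∀ n, AddCommGroup (G n)] : Type u :=
  Π₀ n, G n

noncomputable instance BoxDirectSum.instAddCommGroup (G : ℕ → Type u)
    [∀ n, AddCommGroup (G n)] : AddCommGroup (BoxDirectSum G) :=
  inferInstanceAs (AddCommGroup (Π₀ n, G n))

/-- The `n`-th coordinate of an element of the direct sum. -/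
def BoxDirectSum.coord {G : ℕ → Type u} [∀ n, AddCommGroup (G n)]
    (g : BoxDirectSum G) (n : ℕ) : G n :=
  DFinsupp.toFun g n

/-- The box topology on the direct sum: its open sets are generated by the boxes `∏ U n` (cut down
to the direct sum), where every `U n` is open in `G n`. -/
instance BoxDirectSum.instTopologicalSpace (G : ℕ → Type u) [∀ n, AddCommGroup (G n)]
    [∀ n, TopologicalSpace (G n)] : TopologicalSpace (BoxDirectSum G) :=
  generateFrom {s | ∃ U : (n : ℕ) → Set (G n), (∀ n, IsOpen (U n)) ∧ s = {g | ∀ n, g.coord n ∈ U n}}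

/-- `X` is zero-dimensional: the clopen subsets form a base of its topology. -/
def IsZeroDimensional (X : Type u) [TopologicalSpace X] : Prop :=
  IsTopologicalBasis {s : Set X | IsClopen s}

/-- `X` is the topological sum of a separable locally compact space `L` and a discrete space `D`. -/
def IsSumSeparableLocallyCompactDiscrete (X : Type u) [TopologicalSpace X] : Prop :=
  ∃ L D : Set X, IsOpen L ∧ IsOpen D ∧ IsCompl L D ∧
    SeparableSpace L ∧ LocallyCompactSpace L ∧ DiscreteTopology D

/-- `G` is topologically isomorphic to the product of a Polish abelian group and a compact
(Hausdorff) abelian group. -/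
def IsPolishTimesCompact (G : Type u) [AddCommGroup G] [TopologicalSpace G] : Prop :=
  ∃ (P K : Type u) (_ : AddCommGroup P) (_ : TopologicalSpace P)
    (_ : AddCommGroup K) (_ : TopologicalSpace K),
    IsTopologicalAddGroup P ∧ PolishSpace P ∧
    IsTopologicalAddGroup K ∧ CompactSpace K ∧ T2Space K ∧
    Nonempty (G ≃ₜ+ P × K)

/-- `G` has an open subgroup that is topologically isomorphic to the direct sum of the compact
groups `2 ^ κ n`, with the box topology, for some sequence `κ` of non-zero cardinals.
Each `2 ^ κ n` has the product topology. -/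
def HasOpenBoxSumSubgroup (G : Type u) [AddCommGroup G] [TopologicalSpace G] : Prop :=
  ∃ (H : AddSubgroup G) (κ : ℕ → Cardinal.{u}), IsOpen (H : Set G) ∧ (∀ n, κ n ≠ 0) ∧
    Nonempty (H ≃ₜ+ BoxDirectSum fun n => ((κ n).out → ZMod 2))

/-!
The proof rests on two descriptions. In `C(X, 2)`, the functions that agree with `f` on a compact
set form a neighbourhood base of `f` (`hasBasis_nhds_eqOn`), and compact sets of functions are
equicontinuous (`exists_ball_forall_eq_of_isCompact`).

Necessity: if `C(X, 2)` is a `k`-space, then the derived set `X'` is separable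
(`isSeparable_derivedSet_of_compactlyCoherentSpace`), and it is compact unless `X` is locally
compact (`isCompact_derivedSet_of_compactlyCoherentSpace`). Both are shown by exhibiting a set of
functions that has `0` in its closure but not as a member, while equicontinuity forces its
intersection with every compact set to be closed. The first is a variant of the classical argument
that an uncountable power of `ℕ` is not a `k`-space, the second of the one for the product of a
non-locally compact metrizable group with a direct sum under the box topology. If `X` is locally
compact and `X'` separable, then countably many compact clopen sets cover `X'`, and their union is
the clopen summand `L`.

Sufficiency: for `X = L ⊔ D` restriction gives `C(X, 2) ≃ C(L, 2) × 2 ^ D`, a Polish group times a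
compact one, and such products are `k`-spaces. If `X'` is compact and `X` is not locally compact,
then `X'` has a strictly decreasing clopen neighbourhood base `U n` with `U 0 = X`
(`exists_isDerivedFiltration`). A function that vanishes on `X'` vanishes on some `U n`; so these
functions, which form an open subgroup, are the finite sums of functions on the discrete layers
`U n \ U (n + 1)`, and the compact-open topology becomes the box topology. The functions vanishing on
`U n` form a compact group, and repeated use of the tube lemma (`exists_finset_disjoint`) shows that
the topology is determined by these compact groups and their translates.
-/

open Filter

/-! ### The compact-open topology on maps into a discrete space -/

section DiscreteTarget

variable {X Y : Type*} [TopologicalSpace X] [TopologicalSpace Y] [DiscreteTopology Y]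

lemma isOpen_setOf_eqOn (f : C(X, Y)) {K : Set X} (hK : IsCompact K) :
    IsOpen {g : C(X, Y) | EqOn g f K} := by
  have hfin : (f '' K).Finite := (hK.image f.continuous).finite_of_discrete
  have heq : {g : C(X, Y) | EqOn g f K} =
      ⋂ y ∈ f '' K, {g : C(X, Y) | MapsTo g (K ∩ f ⁻¹' {y}) {y}} := by
    ext g
    simp only [mem_iInter]
    constructor
    · rintro hg y - x ⟨hxK, hxy⟩
      exact (hg hxK).trans hxy
    · intro hg x hxK
      exact hg (f x) (mem_image_of_mem f hxK) ⟨hxK, rfl⟩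
  rw [heq]
  refine hfin.isOpen_biInter fun y _ => ?_
  exact ContinuousMap.isOpen_setOfPred_mapsTo
    (hK.inter_right ((isClosed_discrete {y}).preimage f.continuous)) (isOpen_discrete {y})

lemma hasBasis_nhds_eqOn (f : C(X, Y)) :
    (𝓝 f).HasBasis (fun K : Set X => IsCompact K) fun K => {g : C(X, Y) | EqOn g f K} := by
  refine ⟨fun s => ⟨fun hs => ?_, ?_⟩⟩
  · obtain ⟨S, hfin, hS, hsub⟩ := ContinuousMap.mem_nhds_iff.1 hs
    refine ⟨⋃ p ∈ S, p.1, hfin.isCompact_biUnion fun p hp => (hS p.1 p.2 hp).1, fun g hg => ?_⟩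
    refine hsub fun K U hKU x hx => ?_
    rw [hg (mem_biUnion hKU hx)]
    exact (hS K U hKU).2.2 hx
  · rintro ⟨K, hK, hsub⟩
    exact mem_of_superset ((isOpen_setOf_eqOn f hK).mem_nhds fun x _ => rfl) hsub

lemma isClosed_setOf_apply_eq (x : X) (y : Y) : IsClosed {g : C(X, Y) | g x = y} :=
  (isClosed_discrete {y}).preimage (ContinuousEvalConst.continuous_eval_const x)

end DiscreteTarget

/-- A compact set of continuous maps from a metric space to a discrete space is equicontinuous:
near each point all its members are constant at once. -/
lemma exists_ball_forall_eq_of_isCompact {X Y : Type*} [PseudoMetricSpace X] [TopologicalSpace Y]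
    [DiscreteTopology Y] {C : Set C(X, Y)} (hC : IsCompact C) (x : X) :
    ∃ δ > 0, ∀ f ∈ C, ∀ y, dist y x < δ → f y = f x := by
  by_contra! hcon
  have hpos : ∀ m : ℕ, (0 : ℝ) < 1 / ((m : ℝ) + 1) := fun m => Nat.one_div_pos_of_nat
  choose f hfC y hy hne using fun m : ℕ => hcon _ (hpos m)
  have hlim : Tendsto y atTop (𝓝 x) := by
    rw [tendsto_iff_dist_tendsto_zero]
    exact squeeze_zero (fun _ => dist_nonneg) (fun m => (hy m).le)
      tendsto_one_div_add_atTop_nhds_zero_nat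
  obtain ⟨g, -, hg⟩ := hC.exists_mapClusterPt (f := atTop) (u := f)
    (tendsto_principal.2 (Eventually.of_forall hfC))
  have hfreq : ∃ᶠ m in atTop, EqOn (f m) g (insert x (range y)) :=
    hg.frequently ((isOpen_setOf_eqOn g hlim.isCompact_insert_range).mem_nhds fun x _ => rfl)
  have hev : ∀ᶠ m in atTop, g (y m) = g x :=
    (g.continuous.tendsto x).comp hlim ((isOpen_discrete {g x}).mem_nhds rfl)
  obtain ⟨m, hm, hm'⟩ := (hfreq.and_eventually hev).exists
  refine hne m ?_
  rw [hm (mem_insert_of_mem _ (mem_range_self m)), hm (mem_insert _ _), hm']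

/-- The characteristic function of a clopen set, as a continuous map to `ZMod 2`. -/
noncomputable def clopenChar {X : Type*} [TopologicalSpace X] (B : Set X) (hB : IsClopen B) :
    C(X, ZMod 2) :=
  (LocallyConstant.charFn (ZMod 2) hB : C(X, ZMod 2))

section clopenChar

variable {X : Type*} [TopologicalSpace X] {B : Set X} (hB : IsClopen B) {x : X}

lemma clopenChar_of_mem (hx : x ∈ B) : clopenChar B hB x = 1 := by
  simp [clopenChar, LocallyConstant.coe_charFn, hx]

lemma clopenChar_of_notMem (hx : x ∉ B) : clopenChar B hB x = 0 := by
  simp [clopenChar, LocallyConstant.coe_charFn, hx]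

end clopenChar

/-! ### Clopen sets in zero-dimensional spaces -/

lemma IsZeroDimensional.exists_isClopen {X : Type u} [TopologicalSpace X]
    (hX : IsZeroDimensional X) {x : X} {O : Set X} (hO : IsOpen O) (hx : x ∈ O) :
    ∃ V, IsClopen V ∧ x ∈ V ∧ V ⊆ O :=
  hX.exists_subset_of_mem_open hx hO

lemma IsZeroDimensional.exists_isClopen_of_isCompact {X : Type u} [TopologicalSpace X]
    (hX : IsZeroDimensional X) {K O : Set X} (hK : IsCompact K) (hO : IsOpen O) (hKO : K ⊆ O) :
    ∃ V, IsClopen V ∧ K ⊆ V ∧ V ⊆ O := by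
  choose! V hV hxV hVO using fun x (hx : x ∈ K) => hX.exists_isClopen hO (hKO hx)
  obtain ⟨t, htK, ht⟩ := hK.elim_nhds_subcover V
    fun x hx => (hV x hx).isOpen.mem_nhds (hxV x hx)
  refine ⟨⋃ x ∈ t, V x, t.finite_toSet.isClopen_biUnion fun x hx => hV x (htK x hx), ht, ?_⟩
  exact iUnion₂_subset fun x hx => hVO x (htK x hx)

/-- Around a non-isolated point `x` of an open set there are clopen sets as close to `x` as one
likes that avoid `x` itself. -/
lemma IsZeroDimensional.exists_isClopen_near {X : Type u} [MetricSpace X]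
    (hX : IsZeroDimensional X) {x : X} (hx : x ∈ derivedSet (univ : Set X)) {O : Set X}
    (hO : IsOpen O) (hxO : x ∈ O) {r : ℝ} (hr : 0 < r) :
    ∃ V z, IsClopen V ∧ V ⊆ O ∧ x ∉ V ∧ z ∈ V ∧ dist z x < r := by
  obtain ⟨z, hz, hzx⟩ := accPt_iff_nhds.1 (mem_derivedSet.1 hx) _
    (inter_mem (hO.mem_nhds hxO) (Metric.ball_mem_nhds x hr))
  obtain ⟨V, hV, hzV, hVO⟩ := hX.exists_isClopen (hO.sdiff (isClosed_singleton (x := x)))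
    ⟨hz.1.1, hzx⟩
  exact ⟨V, z, hV, fun y hy => (hVO hy).1, fun h => (hVO h).2 rfl, hzV, hz.1.2⟩

/-! ### Closed sets tested on compact sets -/

lemma CompactlyCoherentSpace.isClosed_of_inter {X : Type*} [TopologicalSpace X]
    [CompactlyCoherentSpace X] {A : Set X} (h : ∀ K, IsCompact K → IsClosed (A ∩ K)) :
    IsClosed A := by
  refine (CompactlyCoherentSpace.isClosed_iff A).2 fun K hK => ?_
  refine isClosed_induced_iff.2 ⟨A ∩ K, h K hK, ?_⟩
  ext x
  simp

lemma CompactlyCoherentSpace.of_isClosed_inter {X : Type*} [TopologicalSpace X] [T2Space X]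
    (h : ∀ A : Set X, (∀ K, IsCompact K → IsClosed (A ∩ K)) → IsClosed A) :
    CompactlyCoherentSpace X := by
  refine CompactlyCoherentSpace.of_isClosed fun A hA => h A fun K hK => ?_
  have h2 := hK.isClosed.isClosedEmbedding_subtypeVal.isClosedMap _ (hA K hK)
  rwa [Subtype.image_preimage_coe, inter_comm] at h2

lemma Homeomorph.compactlyCoherentSpace {X Y : Type*} [TopologicalSpace X] [TopologicalSpace Y]
    [T2Space X] [T2Space Y] [CompactlyCoherentSpace X] (e : X ≃ₜ Y) : CompactlyCoherentSpace Y := by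
  refine .of_isClosed_inter fun A hA => ?_
  rw [← e.isClosed_preimage]
  refine CompactlyCoherentSpace.isClosed_of_inter fun K hK => ?_
  have := (hA _ (hK.image e.continuous)).preimage e.continuous
  rwa [preimage_inter, e.injective.preimage_image] at this

/-! ### Separated families in metric spaces -/

lemma exists_seq_forall_not_mapClusterPt {X : Type*} [PseudoMetricSpace X] {F : Set X}
    (hF : IsClosed F) (hFc : ¬ IsCompact F) :
    ∃ y : ℕ → X, (∀ n, y n ∈ F) ∧ ∀ x, ¬ MapClusterPt x atTop y := by
  rw [isCompact_iff_isSeqCompact] at hFc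
  unfold IsSeqCompact at hFc
  push Not at hFc
  obtain ⟨y, hyF, hy⟩ := hFc
  refine ⟨y, hyF, fun x hx => ?_⟩
  obtain ⟨φ, hφ, hlim⟩ := hx.tendsto_subseq
  exact hy x (hF.mem_of_tendsto hlim (Eventually.of_forall fun n => hyF _)) φ hφ hlim

/-- Sets shrinking to the terms of a sequence without cluster points escape every compact set. -/
lemma eventually_disjoint_of_forall_not_mapClusterPt {X : Type*} [PseudoMetricSpace X] {y : ℕ → X}
    (hy : ∀ x, ¬ MapClusterPt x atTop y) {B : ℕ → Set X}
    (hB : ∀ n : ℕ, B n ⊆ Metric.ball (y n) (1 / ((n : ℝ) + 1))) {K : Set X} (hK : IsCompact K) :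
    ∀ᶠ n in atTop, Disjoint (B n) K := by
  by_contra hcon
  obtain ⟨φ, hφ, hφd⟩ := extraction_of_frequently_atTop (not_eventually.1 hcon)
  choose k hkB hkK using fun n => not_disjoint_iff.1 (hφd n)
  obtain ⟨a, -, ψ, hψ, hlim⟩ := hK.isSeqCompact hkK
  have hmono : Tendsto (φ ∘ ψ) atTop atTop := (hφ.comp hψ).tendsto_atTop
  refine hy a (MapClusterPt.of_comp hmono (Tendsto.mapClusterPt ?_))
  refine (tendsto_iff_of_dist ?_).2 hlim
  refine squeeze_zero (fun _ => dist_nonneg) (fun n => ?_)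
    (tendsto_one_div_add_atTop_nhds_zero_nat.comp hmono)
  rw [dist_comm]
  exact (hB _ (hkB (ψ n))).le

/-- A non-separable set contains an uncountable uniformly separated set. -/
lemma exists_uncountable_separated {X : Type*} [PseudoMetricSpace X] {s : Set X}
    (hs : ¬ IsSeparable s) :
    ∃ ε > 0, ∃ T ⊆ s, ¬ T.Countable ∧ T.Pairwise fun x y => ε ≤ dist x y := by
  by_contra! hcon
  refine hs ?_
  have key : ∀ ε > 0, ∃ t : Set X, t.Countable ∧ s ⊆ ⋃ x ∈ t, Metric.ball x ε := by
    intro ε hε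
    obtain ⟨T, hT⟩ := zorn_subset {T : Set X | T ⊆ s ∧ T.Pairwise fun x y => ε ≤ dist x y} (by
      intro c hc hchain
      refine ⟨⋃₀ c, ⟨sUnion_subset fun t ht => (hc ht).1, ?_⟩, fun t ht => subset_sUnion_of_mem ht⟩
      exact (pairwise_sUnion hchain.directedOn).2 fun t ht => (hc ht).2)
    refine ⟨T, by_contra fun h => hcon ε hε T hT.prop.1 h hT.prop.2, fun x hx => ?_⟩
    by_contra hxT
    simp only [mem_iUnion, Metric.mem_ball, not_exists, not_lt] at hxT
    have hins : insert x T ∈ {T : Set X | T ⊆ s ∧ T.Pairwise fun x y => ε ≤ dist x y} :=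
      ⟨insert_subset hx hT.prop.1, hT.prop.2.insert fun y hy _ =>
        ⟨hxT y hy, by rw [dist_comm]; exact hxT y hy⟩⟩
    have := hxT x (hT.le_of_ge hins (subset_insert x T) (mem_insert x T))
    rw [dist_self] at this
    linarith
  obtain ⟨t, -, htc, ht⟩ := UniformSpace.subset_countable_closure_of_almost_dense_set s
    fun U hU => by
      obtain ⟨ε, hε, hεU⟩ := Metric.mem_uniformity_dist.1 hU
      obtain ⟨t, htc, ht⟩ := key ε hε
      refine ⟨t, htc, ht.trans (iUnion₂_mono fun x _ y hy => hεU ?_)⟩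
      rw [dist_comm]
      exact hy
  exact ⟨t, htc, ht⟩

/-! ### Consequences of the `k`-space property -/

section Necessity

variable {X : Type u} [MetricSpace X]

/-- If `C(X, 2)` is a `k`-space, then the set of non-isolated points is separable. Otherwise there
are uncountably many uniformly separated non-isolated points `s`, each the limit of points `z s n`.
Let `A n` consist of the functions that vanish at all `s` and at no more than `n` of the points
`z s n`. By equicontinuity and the pigeonhole principle a compact set meets only finitely many of
the closed sets `A n`, yet `0` lies in the closure of `⋃ n, A n` without being a member. -/
lemma isSeparable_derivedSet_of_compactlyCoherentSpace (hX : IsZeroDimensional X)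
    [CompactlyCoherentSpace C(X, ZMod 2)] : IsSeparable (derivedSet (univ : Set X)) := by
  by_contra hsep
  obtain ⟨ε, hε, S, hSX, hSc, hS⟩ := exists_uncountable_separated hsep
  have hballs : LocallyFinite fun s : S => Metric.ball (s : X) (ε / 4) := by
    intro x
    refine ⟨Metric.ball x (ε / 4), Metric.ball_mem_nhds x (by positivity), ?_⟩
    refine Set.Subsingleton.finite fun s hs t ht => ?_
    obtain ⟨a, has, hax⟩ := hs
    obtain ⟨b, hbt, hbx⟩ := ht
    by_contra hst
    have h1 := hS s.2 t.2 fun h => hst (Subtype.ext h)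
    simp only [Metric.mem_ball] at has hax hbt hbx
    have h2 := dist_triangle4_left (s : X) t a x
    have h3 := dist_triangle4 (s : X) a x t
    have h4 := dist_triangle x b (t : X)
    rw [dist_comm (s : X) a] at h3
    rw [dist_comm x b] at h4
    linarith
  choose V z hV hVb hsV hzV hzs using fun (s : S) (n : ℕ) =>
    hX.exists_isClopen_near (hSX s.2) (Metric.isOpen_ball (x := (s : X)) (ε := ε / 4))
      (Metric.mem_ball_self (by positivity)) (Nat.one_div_pos_of_nat (α := ℝ) (n := n))
  let A : ℕ → Set C(X, ZMod 2) := fun n => {f | (∀ s : S, f s = 0) ∧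
    ∀ T : Finset S, (∀ s ∈ T, f (z s n) = 0) → T.card ≤ n}
  have hAclosed : ∀ n, IsClosed (A n) := by
    intro n
    have heq : A n = (⋂ s : S, {f : C(X, ZMod 2) | f s = 0}) ∩
        ⋂ (T : Finset S) (_ : n < T.card), (⋂ s ∈ T, {f : C(X, ZMod 2) | f (z s n) = 0})ᶜ := by
      ext f
      simp only [A, mem_inter_iff, mem_iInter, mem_compl_iff, mem_ofPred_eq]
      refine and_congr_right fun _ => forall_congr' fun T => ?_
      rw [← not_lt]
      tauto
    rw [heq]
    refine (isClosed_iInter fun s => isClosed_setOf_apply_eq _ _).inter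
      (isClosed_iInter fun T => isClosed_iInter fun _ => IsOpen.isClosed_compl ?_)
    exact isOpen_biInter_finset fun s _ =>
      (isOpen_discrete {0}).preimage (ContinuousEvalConst.continuous_eval_const (z s n))
  have hSinf : Infinite S := by
    by_contra h
    rw [not_infinite_iff_finite] at h
    exact hSc (toFinite S).countable
  have hzero : (0 : C(X, ZMod 2)) ∉ ⋃ n, A n := by
    rintro h
    obtain ⟨n, -, hn⟩ := mem_iUnion.1 h
    obtain ⟨T, hT⟩ := Infinite.exists_subset_card_eq S (n + 1)
    have := hn T fun s _ => rfl
    omega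
  have hclosed : IsClosed (⋃ n, A n) := by
    refine CompactlyCoherentSpace.isClosed_of_inter fun C hC => ?_
    choose δ hδ hδC using fun s : S => exists_ball_forall_eq_of_isCompact hC (s : X)
    choose c hc using fun s : S => exists_nat_one_div_lt (hδ s)
    obtain ⟨m, hm⟩ : ∃ m, {s : S | c s = m}.Infinite := by
      by_contra! h
      refine hSc (countable_coe_iff.1 (countable_univ_iff.1 ?_))
      exact (countable_iUnion fun m => (h m).countable).mono fun s _ =>
        mem_iUnion.2 ⟨c s, (rfl : c s = c s)⟩
    have heq : (⋃ n, A n) ∩ C = ⋃ n ∈ Iio m, (A n ∩ C) := by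
      ext f
      simp only [mem_inter_iff, mem_iUnion, exists_prop]
      refine ⟨?_, fun ⟨n, _, hn, hfC⟩ => ⟨⟨n, hn⟩, hfC⟩⟩
      rintro ⟨⟨n, hn⟩, hfC⟩
      refine ⟨n, ?_, hn, hfC⟩
      by_contra hnm
      obtain ⟨T, hTm, hT⟩ := hm.exists_subset_card_eq (n + 1)
      have := hn.2 T fun s hs => by
        refine (hδC s f hfC _ ((hzs s n).trans (lt_of_le_of_lt ?_ (hc s)))).trans (hn.1 s)
        have hcs : c s = m := hTm hs
        rw [hcs]
        exact Nat.one_div_le_one_div (not_lt.1 hnm)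
      omega
    rw [heq]
    exact (finite_Iio m).isClosed_biUnion fun n _ => (hAclosed n).inter hC.isClosed
  refine hzero (hclosed.closure_subset ?_)
  rw [mem_closure_iff_nhds_basis (hasBasis_nhds_eqOn 0)]
  intro K hK
  have hfin := hballs.finite_nonempty_inter_compact hK
  -- The balls around the members of `F` may meet `K`, so the witness vanishes there; that leaves
  -- `F.card` of the points `z s n` at which it is `0`, as `A F.card` permits.
  set F : Finset S := hfin.toFinset
  have hlf : LocallyFinite fun s : {s : S // s ∉ F} => V s F.card :=
    (hballs.comp_injective Subtype.val_injective).subset fun s => hVb s _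
  have hclopen : IsClopen (⋃ s : {s : S // s ∉ F}, V s F.card) :=
    ⟨hlf.isClosed_iUnion fun s => (hV s _).isClosed, isOpen_iUnion fun s => (hV s _).isOpen⟩
  refine ⟨clopenChar _ hclopen, mem_iUnion.2 ⟨F.card, ?_, ?_⟩, ?_⟩
  · refine fun t => clopenChar_of_notMem _ fun ht => ?_
    obtain ⟨s, hs⟩ := mem_iUnion.1 ht
    by_cases hst : (s : S) = t
    · exact hsV t F.card (hst ▸ hs)
    · have h1 := hS (s : S).2 t.2 fun h => hst (Subtype.ext h)
      have h2 := hVb _ _ hs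
      rw [Metric.mem_ball, dist_comm] at h2
      linarith
  · intro T hT
    refine Finset.card_le_card fun s hs => ?_
    by_contra hsF
    have h1 := hT s hs
    rw [clopenChar_of_mem hclopen (mem_iUnion.2 ⟨⟨s, hsF⟩, hzV s _⟩)] at h1
    exact one_ne_zero h1
  · refine fun x hx => clopenChar_of_notMem _ fun hxV => ?_
    obtain ⟨s, hs⟩ := mem_iUnion.1 hxV
    exact s.2 (hfin.mem_toFinset.2 ⟨x, hVb _ _ hs, hx⟩)

/-- If `C(X, 2)` is a `k`-space and `X` is not locally compact, then the set of non-isolated points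
is compact. Otherwise take a point `x` without compact neighbourhoods and non-isolated points `p n`
without cluster points. Consider the characteristic functions `f n j` of a clopen set close to `p n`
(the closer, the larger `j`) together with a small clopen set around the `j`-th term of a sequence
without cluster points in the ball of radius `1 / (n + 1)` around `x`. Equicontinuity at `x` bounds
`n`, and equicontinuity at `p n` bounds `j`, so that a compact set contains only finitely many
`f n j`; but `0` lies in their closure. -/
lemma isCompact_derivedSet_of_compactlyCoherentSpace (hX : IsZeroDimensional X)
    [CompactlyCoherentSpace C(X, ZMod 2)] (hnlc : ¬ LocallyCompactSpace X) :
    IsCompact (derivedSet (univ : Set X)) := by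
  by_contra hnc
  obtain ⟨x, hx⟩ : ∃ x : X, ∀ K, IsCompact K → K ∉ 𝓝 x := by
    by_contra! h
    have : WeaklyLocallyCompactSpace X := ⟨h⟩
    exact hnlc inferInstance
  obtain ⟨p, hpX, hp⟩ := exists_seq_forall_not_mapClusterPt (isClosed_derivedSet _) hnc
  have hpos : ∀ n : ℕ, (0 : ℝ) < 1 / ((n : ℝ) + 1) := fun n => Nat.one_div_pos_of_nat
  choose y hyx hy using fun n : ℕ =>
    exists_seq_forall_not_mapClusterPt (Metric.isClosed_closedBall (x := x))
      fun h => hx _ h (Metric.closedBall_mem_nhds x (hpos n))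
  choose B z hB hBp hpB hzB hzp using fun n j : ℕ =>
    hX.exists_isClopen_near (hpX n) (Metric.isOpen_ball (x := p n) (ε := 1 / ((n : ℝ) + 1)))
      (Metric.mem_ball_self (hpos n)) (hpos j)
  choose E hE hyE hEy using fun n j : ℕ =>
    hX.exists_isClopen (Metric.isOpen_ball (x := y n j) (ε := 1 / ((j : ℝ) + 1)))
      (Metric.mem_ball_self (hpos j))
  have hBall : ∀ K, IsCompact K →
      ∀ᶠ n : ℕ in atTop, Disjoint (Metric.ball (p n) (1 / ((n : ℝ) + 1))) K := fun K hK =>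
    eventually_disjoint_of_forall_not_mapClusterPt hp (fun _ => Subset.rfl) hK
  have hEK : ∀ n K, IsCompact K → ∀ᶠ j in atTop, Disjoint (E n j) K := fun n K hK =>
    eventually_disjoint_of_forall_not_mapClusterPt (hy n) (hEy n) hK
  let f : ℕ → ℕ → C(X, ZMod 2) := fun n j => clopenChar (B n j ∪ E n j) ((hB n j).union (hE n j))
  -- Only functions vanishing at `x` and at `p n` are of use for the equicontinuity argument.
  let I : Set (ℕ × ℕ) := {q | f q.1 q.2 x = 0 ∧ f q.1 q.2 (p q.1) = 0}
  let A : Set C(X, ZMod 2) := (fun q : ℕ × ℕ => f q.1 q.2) '' I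
  have hzero : (0 : C(X, ZMod 2)) ∉ A := by
    rintro ⟨q, -, hq⟩
    have h1 : f q.1 q.2 (y q.1 q.2) = 1 := clopenChar_of_mem _ (Or.inr (hyE _ _))
    simp only at hq
    rw [hq] at h1
    exact zero_ne_one h1
  have hclosed : IsClosed A := by
    refine CompactlyCoherentSpace.isClosed_of_inter fun C hC => Set.Finite.isClosed ?_
    obtain ⟨δ, hδ, hδC⟩ := exists_ball_forall_eq_of_isCompact hC x
    choose η hη hηC using fun n => exists_ball_forall_eq_of_isCompact hC (p n)
    obtain ⟨M, hM⟩ := exists_nat_one_div_lt hδ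
    choose J hJ using fun n => exists_nat_one_div_lt (hη n)
    have hfin : (⋃ n ∈ Iio M, {n} ×ˢ Iio (J n)).Finite :=
      (finite_Iio M).biUnion fun n _ => (finite_singleton n).prod (finite_Iio (J n))
    refine (hfin.image fun q : ℕ × ℕ => f q.1 q.2).subset ?_
    rintro _ ⟨⟨q, ⟨hqx, hqp⟩, rfl⟩, hqC⟩
    refine mem_image_of_mem _ (mem_biUnion (x := q.1) ?_ (mk_mem_prod rfl ?_))
    · by_contra hqM
      have h1 : f q.1 q.2 (y q.1 q.2) = 1 := clopenChar_of_mem _ (Or.inr (hyE _ _))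
      rw [hδC _ hqC _ (((hyx q.1 q.2).trans
        (Nat.one_div_le_one_div (not_lt.1 hqM))).trans_lt hM), hqx] at h1
      exact zero_ne_one h1
    · by_contra hqJ
      have h1 : f q.1 q.2 (z q.1 q.2) = 1 := clopenChar_of_mem _ (Or.inl (hzB _ _))
      rw [hηC _ _ hqC _ (((hzp q.1 q.2).le.trans
        (Nat.one_div_le_one_div (not_lt.1 hqJ))).trans_lt (hJ _)), hqp] at h1
      exact zero_ne_one h1
  refine hzero (hclosed.closure_subset ?_)
  rw [mem_closure_iff_nhds_basis (hasBasis_nhds_eqOn 0)]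
  intro K hK
  obtain ⟨n, hn⟩ := (hBall (insert x K) (hK.insert x)).exists
  obtain ⟨j, hj⟩ := (hEK n (insert (p n) (insert x K)) ((hK.insert x).insert _)).exists
  have hvanish : ∀ t ∈ insert x K, f n j t = 0 := fun t ht => clopenChar_of_notMem _ <| by
    rintro (h | h)
    · exact disjoint_left.1 hn (hBp n j h) ht
    · exact disjoint_left.1 hj h (mem_insert_of_mem _ ht)
  refine ⟨f n j, ⟨(n, j), ⟨hvanish x (mem_insert _ _), ?_⟩, rfl⟩, fun t ht =>
    hvanish t (mem_insert_of_mem _ ht)⟩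
  refine clopenChar_of_notMem _ ?_
  rintro (h | h)
  · exact hpB n j h
  · exact disjoint_left.1 hj h (mem_insert _ _)

end Necessity

/-! ### Sums of a separable locally compact and a discrete space -/

lemma isOpen_singleton_of_notMem_derivedSet {X : Type*} [TopologicalSpace X] {x : X}
    (hx : x ∉ derivedSet (univ : Set X)) : IsOpen ({x} : Set X) := by
  rw [isOpen_singleton_iff_punctured_nhds]
  by_contra h
  refine hx (mem_derivedSet.2 ?_)
  rw [accPt_principal_iff_nhdsWithin, ← compl_eq_univ_sdiff]
  exact ⟨h⟩

/-- A locally compact zero-dimensional metric space with separable derived set is the sum of a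
separable and a discrete space. A union `L` of countably many compact clopen sets covers all
non-isolated points; being open and containing its limit points, `L` is clopen. -/
lemma isSumSeparableLocallyCompactDiscrete_of_isSeparable {X : Type u} [MetricSpace X]
    (hX : IsZeroDimensional X) [LocallyCompactSpace X]
    (hsep : IsSeparable (derivedSet (univ : Set X))) :
    IsSumSeparableLocallyCompactDiscrete X := by
  have hV : ∀ x : X, ∃ V, IsClopen V ∧ x ∈ V ∧ IsCompact V := by
    intro x
    obtain ⟨K, hK, hxK⟩ := exists_compact_mem_nhds x
    obtain ⟨V, hV, hxV, hVK⟩ := hX.exists_isClopen isOpen_interior (mem_interior_iff_mem_nhds.2 hxK)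
    exact ⟨V, hV, hxV, hK.of_isClosed_subset hV.isClosed (hVK.trans interior_subset)⟩
  choose V hV hxV hVc using hV
  have hlin : IsLindelof (derivedSet (univ : Set X)) := by
    have := hsep.secondCountableTopology
    exact isLindelof_iff_lindelofSpace.2 inferInstance
  obtain ⟨t, ht, -, htV⟩ := hlin.elim_nhds_subcover V fun x _ => (hV x).isOpen.mem_nhds (hxV x)
  set L := ⋃ x ∈ t, V x with hL
  have hLo : IsOpen L := isOpen_biUnion fun x _ => (hV x).isOpen
  have hLc : IsClosed L := by
    rw [isClosed_iff_derivedSet_subset]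
    exact (derivedSet_mono _ _ (subset_univ L)).trans htV
  refine ⟨L, Lᶜ, hLo, hLc.isOpen_compl, isCompl_compl, ?_, hLo.locallyCompactSpace, ?_⟩
  · refine IsSeparable.separableSpace ?_
    have : Countable t := ht
    rw [hL, biUnion_eq_iUnion]
    exact IsSeparable.iUnion fun x => (hVc x).isSeparable
  · refine discreteTopology_iff_isOpen_singleton.2 fun x => ?_
    have := (isOpen_singleton_of_notMem_derivedSet fun h => x.2 (htV h)).preimage
      (continuous_subtype_val (p := (· ∈ Lᶜ)))
    convert this
    ext y
    simp [Subtype.ext_iff]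

/-- A bijective continuous open homomorphism, as an isomorphism of topological groups. -/
noncomputable def ContinuousAddEquiv.ofBijective {G H : Type*} [AddCommGroup G]
    [TopologicalSpace G] [AddCommGroup H] [TopologicalSpace H] (φ : G →+ H)
    (hφ : Function.Bijective φ) (hcont : Continuous φ) (hopen : IsOpenMap φ) : G ≃ₜ+ H :=
  .mk' ((Equiv.ofBijective φ hφ).toHomeomorphOfContinuousOpen hcont hopen) (map_add φ)

lemma exists_continuousMap_glue {X Y : Type*} [TopologicalSpace X] [TopologicalSpace Y]
    {L D : Set X} (hL : IsOpen L) (hD : IsOpen D) (hLD : IsCompl L D) (g : C(L, Y)) (h : C(D, Y)) :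
    ∃ f : C(X, Y), (∀ x : L, f x = g x) ∧ ∀ x : D, f x = h x := by
  classical
  obtain rfl := hLD.compl_eq
  let f : X → Y := fun x => if hx : x ∈ L then g ⟨x, hx⟩ else h ⟨x, hx⟩
  have hfL : ∀ x : L, f x = g x := fun x => dif_pos x.2
  have hfD : ∀ x : (Lᶜ : Set X), f x = h x := fun x => dif_neg x.2
  refine ⟨⟨f, continuous_iff_continuousAt.2 fun x => ?_⟩, hfL, hfD⟩
  by_cases hx : x ∈ L
  · have : Continuous fun x : L => f x := by simpa only [hfL] using g.continuous
    exact (continuousOn_iff_continuous_domRestrict.2 this).continuousAt (hL.mem_nhds hx)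
  · have : Continuous fun x : (Lᶜ : Set X) => f x := by simpa only [hfD] using h.continuous
    exact (continuousOn_iff_continuous_domRestrict.2 this).continuousAt (hD.mem_nhds hx)

/-- For a clopen decomposition `X = L ⊔ D`, restriction is an isomorphism
`C(X, G) ≃ C(L, G) × C(D, G)`. -/
lemma nonempty_continuousAddEquiv_prod {X G : Type*} [TopologicalSpace X] [AddCommGroup G]
    [TopologicalSpace G] [DiscreteTopology G] [IsTopologicalAddGroup G]
    {L D : Set X} (hL : IsOpen L) (hD : IsOpen D) (hLD : IsCompl L D) :
    Nonempty (C(X, G) ≃ₜ+ C(L, G) × C(D, G)) := by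
  let φ : C(X, G) →+ C(L, G) × C(D, G) :=
    { toFun := fun f => (f.restrict L, f.restrict D)
      map_zero' := rfl
      map_add' := fun _ _ => rfl }
  have hmem : ∀ x, x ∈ L ∨ x ∈ D := fun x => (hLD.sup_eq_top.ge (mem_univ x) : x ∈ L ∪ D)
  have hsurj : ∀ (g : C(L, G)) (h : C(D, G)), ∃ f : C(X, G),
      (∀ x : L, f x = g x) ∧ ∀ x : D, f x = h x :=
    exists_continuousMap_glue hL hD hLD
  have hLc : IsClosed L := by rw [← hLD.symm.compl_eq]; exact hD.isClosed_compl
  have hDc : IsClosed D := by rw [← hLD.compl_eq]; exact hL.isClosed_compl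
  refine ⟨.ofBijective φ ⟨fun f f' hff => ?_, fun ⟨g, h⟩ => ?_⟩ ?_ ?_⟩
  · have h1 := congrArg Prod.fst hff
    have h2 := congrArg Prod.snd hff
    ext x
    rcases hmem x with hx | hx
    · exact DFunLike.congr_fun h1 ⟨x, hx⟩
    · exact DFunLike.congr_fun h2 ⟨x, hx⟩
  · obtain ⟨f, hf, hf'⟩ := hsurj g h
    exact ⟨f, Prod.ext (ContinuousMap.ext hf) (ContinuousMap.ext hf')⟩
  · exact (ContinuousMap.continuous_restrict L).prodMk (ContinuousMap.continuous_restrict D)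
  · refine isOpenMap_iff_nhds_le.2 fun f s hs => ?_
    obtain ⟨K, hK, hKs⟩ := (hasBasis_nhds_eqOn f).mem_iff.1 hs
    have hKL := hLc.isClosedEmbedding_subtypeVal.isCompact_preimage hK
    have hKD := hDc.isClosedEmbedding_subtypeVal.isCompact_preimage hK
    refine mem_of_superset (prod_mem_nhds
      ((hasBasis_nhds_eqOn (f.restrict L)).mem_of_mem hKL)
      ((hasBasis_nhds_eqOn (f.restrict D)).mem_of_mem hKD)) ?_
    rintro ⟨g, h⟩ ⟨hg, hh⟩
    obtain ⟨f', hf, hf'⟩ := hsurj g h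
    have hφ : φ f' = (g, h) := Prod.ext (ContinuousMap.ext hf) (ContinuousMap.ext hf')
    rw [← hφ]
    refine hKs fun x hx => ?_
    rcases hmem x with hxL | hxD
    · exact (hf ⟨x, hxL⟩).trans (hg (x := ⟨x, hxL⟩) hx)
    · exact (hf' ⟨x, hxD⟩).trans (hh (x := ⟨x, hxD⟩) hx)

/-- `L` is σ-compact, so that compact convergence is countably generated and complete. -/
lemma polishSpace_continuousMap (L : Type*) [MetricSpace L] [SeparableSpace L]
    [LocallyCompactSpace L] : PolishSpace C(L, ZMod 2) := by
  have := UniformSpace.secondCountable_of_separable L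
  let : UniformSpace (ZMod 2) := ⊥
  have : SecondCountableTopology C(L, ZMod 2) := inferInstance
  have : CompleteSpace C(L, ZMod 2) := inferInstance
  have : (uniformity (ZMod 2)).IsCountablyGenerated := by
    rw [bot_uniformity]
    infer_instance
  have : (uniformity C(L, ZMod 2)).IsCountablyGenerated := inferInstance
  have : T0Space C(L, ZMod 2) := inferInstance
  have : IsCompletelyMetrizableSpace C(L, ZMod 2) := inferInstance
  infer_instance

lemma IsSumSeparableLocallyCompactDiscrete.isPolishTimesCompact {X : Type u} [MetricSpace X]
    (h : IsSumSeparableLocallyCompactDiscrete X) : IsPolishTimesCompact C(X, ZMod 2) := by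
  obtain ⟨L, D, hL, hD, hLD, hLs, hLc, hDd⟩ := h
  exact ⟨C(L, ZMod 2), C(D, ZMod 2), inferInstance, inferInstance, inferInstance, inferInstance,
    inferInstance, polishSpace_continuousMap L, inferInstance,
    (ContinuousMap.homeoFnOfDiscrete (X := D) (Y := ZMod 2)).symm.compactSpace, inferInstance,
    nonempty_continuousAddEquiv_prod hL hD hLD⟩

/-- The product of a Fréchet–Urysohn space and a compact space is a `k`-space: above a compact
neighbourhood `W` in the second factor, the projection of a compactly closed set to the first
factor is sequentially closed. -/
lemma compactlyCoherentSpace_prod {P K : Type*} [TopologicalSpace P] [TopologicalSpace K]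
    [T2Space P] [FrechetUrysohnSpace P] [T2Space K] [CompactSpace K] :
    CompactlyCoherentSpace (P × K) := by
  refine .of_isClosed_inter fun A hA => isOpen_compl_iff.1 (isOpen_iff_mem_nhds.2 ?_)
  rintro ⟨p, k⟩ hpk
  have hfib : IsClosed {w : K | (p, w) ∈ A} := by
    have := (hA ({p} ×ˢ univ) (isCompact_singleton.prod isCompact_univ)).preimage
      (Continuous.prodMk_right (Y := K) p)
    convert this using 1
    ext w
    simp
  obtain ⟨W, hWk, hWc, hWA⟩ := exists_mem_nhds_isClosed_subset (hfib.isOpen_compl.mem_nhds hpk)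
  have hp : p ∉ closure (Prod.fst '' (A ∩ univ ×ˢ W)) := by
    intro hp
    obtain ⟨q, hq, hlim⟩ := mem_closure_iff_seq_limit.1 hp
    have hcomp : IsCompact (A ∩ (insert p (range q)) ×ˢ W) :=
      (hlim.isCompact_insert_range.prod hWc.isCompact).of_isClosed_subset
        (hA _ (hlim.isCompact_insert_range.prod hWc.isCompact)) inter_subset_right
    obtain ⟨⟨p', w⟩, ⟨haA, -, haW⟩, rfl⟩ :=
      (hcomp.image continuous_fst).isClosed.mem_of_tendsto hlim (Eventually.of_forall fun n => by
        obtain ⟨a, ⟨haA, -, haW⟩, ha⟩ := hq n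
        exact ⟨a, ⟨haA, mem_insert_of_mem _ ⟨n, ha.symm⟩, haW⟩, ha⟩)
    exact hWA haW haA
  filter_upwards [prod_mem_nhds (isClosed_closure.isOpen_compl.mem_nhds hp) hWk]
  rintro ⟨p', w⟩ ⟨hp', hw⟩ ha
  exact hp' (subset_closure ⟨(p', w), ⟨ha, trivial, hw⟩, rfl⟩)

lemma IsPolishTimesCompact.compactlyCoherentSpace {G : Type u} [AddCommGroup G]
    [TopologicalSpace G] [T2Space G] (h : IsPolishTimesCompact G) : CompactlyCoherentSpace G := by
  obtain ⟨P, K, _, _, _, _, _, _, _, _, _, ⟨e⟩⟩ := h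
  have : CompactlyCoherentSpace (P × K) := compactlyCoherentSpace_prod
  exact e.toHomeomorph.symm.compactlyCoherentSpace

/-! ### Spaces with a compact set of non-isolated points -/

/-- A strictly decreasing sequence of clopen sets that starts with the whole space and is a
neighbourhood base of the set of non-isolated points. -/
structure IsDerivedFiltration {X : Type*} [TopologicalSpace X] (U : ℕ → Set X) : Prop where
  zero : U 0 = univ
  antitone : Antitone U
  isClopen : ∀ n, IsClopen (U n)
  derivedSet_subset : ∀ n, derivedSet univ ⊆ U n
  exists_subset : ∀ O, IsOpen O → derivedSet univ ⊆ O → ∃ n, U n ⊆ O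
  nonempty_diff : ∀ n, (U n \ U (n + 1)).Nonempty

lemma exists_isDerivedFiltration {X : Type u} [MetricSpace X] (hX : IsZeroDimensional X)
    (hnlc : ¬ LocallyCompactSpace X) (hc : IsCompact (derivedSet (univ : Set X))) :
    ∃ U : ℕ → Set X, IsDerivedFiltration U := by
  -- Otherwise the derived set would be open as well as compact, and `X` locally compact.
  have hne : ∀ V : Set X, IsClopen V → derivedSet univ ⊆ V → ∃ x ∈ V, x ∉ derivedSet univ := by
    intro V hV hXV
    by_contra! h
    have hVX : V = derivedSet univ := Subset.antisymm h hXV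
    refine hnlc ?_
    have : WeaklyLocallyCompactSpace X := by
      refine ⟨fun x => ?_⟩
      by_cases hx : x ∈ derivedSet (univ : Set X)
      · exact ⟨_, hc, hVX ▸ hV.isOpen.mem_nhds (hVX ▸ hx)⟩
      · exact ⟨{x}, isCompact_singleton,
          (isOpen_singleton_of_notMem_derivedSet hx).mem_nhds rfl⟩
    infer_instance
  have hstep : ∀ (m : ℕ) (V : {V : Set X // IsClopen V ∧ derivedSet univ ⊆ V}),
      ∃ W : {V : Set X // IsClopen V ∧ derivedSet univ ⊆ V}, W.1 ⊆ V.1 ∧ (V.1 \ W.1).Nonempty ∧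
        W.1 ⊆ Metric.thickening (1 / ((m : ℝ) + 1)) (derivedSet univ) := by
    rintro m ⟨V, hV, hXV⟩
    obtain ⟨x, hxV, hx⟩ := hne V hV hXV
    obtain ⟨W, hW, hXW, hWO⟩ := hX.exists_isClopen_of_isCompact hc
      ((hV.isOpen.inter (isOpen_compl_singleton (x := x))).inter
        (Metric.isOpen_thickening (δ := 1 / ((m : ℝ) + 1)) (E := derivedSet univ)))
      fun y hy => ⟨⟨hXV hy, fun h => hx (h ▸ hy)⟩,
        Metric.self_subset_thickening Nat.one_div_pos_of_nat _ hy⟩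
    exact ⟨⟨W, hW, hXW⟩, fun y hy => (hWO hy).1.1, ⟨x, hxV, fun h => (hWO h).1.2 rfl⟩,
      fun y hy => (hWO hy).2⟩
  choose W hWV hWne hWth using hstep
  let S : ℕ → {V : Set X // IsClopen V ∧ derivedSet univ ⊆ V} :=
    fun n => Nat.rec ⟨univ, isClopen_univ, subset_univ _⟩ W n
  refine ⟨fun n => (S n).1, rfl, antitone_nat_of_succ_le fun n => hWV n (S n), fun n => (S n).2.1,
    fun n => (S n).2.2, fun O hO hXO => ?_, fun n => hWne n (S n)⟩
  obtain ⟨δ, hδ, hδO⟩ := hc.exists_thickening_subset_open hO hXO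
  obtain ⟨m, hm⟩ := exists_nat_one_div_lt hδ
  exact ⟨m + 1, (hWth m (S m)).trans ((Metric.thickening_mono hm.le _).trans hδO)⟩

namespace IsDerivedFiltration

section Topological

variable {X Y : Type*} [TopologicalSpace X] {U : ℕ → Set X} (hU : IsDerivedFiltration U)

include hU

lemma isOpen_singleton {n : ℕ} {x : X} (hx : x ∉ U n) : IsOpen ({x} : Set X) :=
  isOpen_singleton_of_notMem_derivedSet fun h => hx (hU.derivedSet_subset n h)

lemma exists_mem_diff [T1Space X] {x : X} (hx : x ∉ derivedSet (univ : Set X)) :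
    ∃ n, x ∈ U n \ U (n + 1) := by
  classical
  have hex : ∃ n, x ∉ U n := by
    obtain ⟨n, hn⟩ := hU.exists_subset {x}ᶜ isOpen_compl_singleton fun y hy h => hx (h ▸ hy)
    exact ⟨n, fun h => hn h rfl⟩
  obtain ⟨n, hn⟩ := Nat.exists_eq_succ_of_ne_zero (n := Nat.find hex) fun h =>
    Nat.find_spec hex (by rw [h, hU.zero]; trivial)
  exact ⟨n, not_not.1 (Nat.find_min hex (by omega)), by
    have := Nat.find_spec hex
    rwa [hn] at this⟩

lemma eq_of_mem_diff {m n : ℕ} {x : X} (hm : x ∈ U m \ U (m + 1)) (hn : x ∈ U n \ U (n + 1)) :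
    m = n := by
  by_contra hne
  rcases lt_or_gt_of_ne hne with h | h
  · exact hm.2 (hU.antitone h hn.1)
  · exact hn.2 (hU.antitone h hm.1)

lemma finite_diff_of_isCompact {K : Set X} (hK : IsCompact K) (n : ℕ) : (K \ U n).Finite := by
  by_contra hinf
  obtain ⟨x, hx, hacc⟩ := Set.Infinite.exists_accPt_of_subset_isCompact hinf
    (hK.diff (hU.isClopen n).isOpen) Subset.rfl
  exact hx.2 (hU.derivedSet_subset n (hacc.mono (principal_mono.2 (subset_univ _))))

/-- The set of non-isolated points stays compact when finitely many points of each layer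
`U n \ U (n + 1)` are added. -/
lemma isCompact_union (hc : IsCompact (derivedSet (univ : Set X))) {F : ℕ → Set X}
    (hF : ∀ n, (F n).Finite) (hFU : ∀ n, F n ⊆ U n) :
    IsCompact (derivedSet univ ∪ ⋃ n, F n) := by
  refine isCompact_of_finite_subcover fun {ι} V hV hsub => ?_
  classical
  obtain ⟨t, ht⟩ := hc.elim_finite_subcover V hV (subset_union_left.trans hsub)
  obtain ⟨m, hm⟩ := hU.exists_subset _ (isOpen_biUnion fun i _ => hV i) ht
  obtain ⟨t', ht'⟩ := ((finite_Iio m).biUnion fun n _ => hF n).isCompact.elim_finite_subcover V hV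
    ((iUnion₂_subset fun n _ => (subset_iUnion F n).trans subset_union_right).trans hsub)
  refine ⟨t ∪ t', ?_⟩
  rw [Finset.set_biUnion_union]
  refine union_subset (ht.trans subset_union_left) (iUnion_subset fun n => ?_)
  rcases lt_or_ge n m with h | h
  · exact (subset_biUnion_of_mem (u := F) (mem_Iio.2 h)).trans (ht'.trans subset_union_right)
  · exact ((hFU n).trans (hU.antitone h)).trans (hm.trans subset_union_left)

lemma continuous_of_eqOn [TopologicalSpace Y] {n : ℕ} {f : C(X, Y)} {h : X → Y}
    (hfh : EqOn h f (U n)) : Continuous h := by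
  refine continuous_iff_continuousAt.2 fun x => ?_
  by_cases hx : x ∈ U n
  · exact f.continuous.continuousAt.congr
      ((hfh.symm).eventuallyEq_of_mem ((hU.isClopen n).isOpen.mem_nhds hx))
  · rw [ContinuousAt, (isOpen_singleton_iff_nhds_eq_pure x).1 (hU.isOpen_singleton hx)]
    exact tendsto_pure_nhds h x

variable [TopologicalSpace Y] [DiscreteTopology Y]

lemma exists_eqOn {f g : C(X, Y)} (h : EqOn f g (derivedSet univ)) : ∃ n, EqOn f g (U n) := by
  have hopen : IsOpen {x | f x = g x} :=
    (isOpen_discrete {p : Y × Y | p.1 = p.2}).preimage (f.continuous.prodMk g.continuous)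
  exact hU.exists_subset _ hopen h

/-- Off `U n` the space is discrete, so that the maps agreeing with a given one on `U n` form a
power of `Y`. -/
lemma isCompact_setOf_eqOn [Finite Y] (f : C(X, Y)) (n : ℕ) :
    IsCompact {g : C(X, Y) | EqOn g f (U n)} := by
  classical
  let Φ : (X → Y) → C(X, Y) := fun h => ⟨(U n).piecewise f h,
    hU.continuous_of_eqOn (piecewise_eqOn (U n) f h)⟩
  have hΦ : Continuous Φ := by
    refine continuous_iff_continuousAt.2 fun h => ?_
    refine (hasBasis_nhds_eqOn (Φ h)).tendsto_right_iff.2 fun K hK => ?_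
    have hnhds : ∀ᶠ h' in 𝓝 h, ∀ x ∈ K \ U n, h' x = h x := by
      refine (hU.finite_diff_of_isCompact hK n).eventually_all.2 fun x _ => ?_
      exact (continuous_apply x).tendsto h ((isOpen_discrete {h x}).mem_nhds rfl)
    filter_upwards [hnhds] with h' hh' x hx
    by_cases hxU : x ∈ U n
    · simp [Φ, hxU]
    · simpa [Φ, hxU] using hh' x ⟨hx, hxU⟩
  convert isCompact_range hΦ
  ext g
  constructor
  · intro hg
    refine ⟨g, ContinuousMap.ext fun x => ?_⟩
    by_cases hxU : x ∈ U n
    · simpa [Φ, hxU] using (hg hxU).symm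
    · simp [Φ, hxU]
  · rintro ⟨h, rfl⟩
    exact piecewise_eqOn (U n) f h

/-- If the maps that agree with `f` on `U n` and on `G` all avoid `B`, then so do those that agree
with `f` on the smaller set `U (n + 1)`, on `G`, and on finitely many further points of `U n`: a
form of the tube lemma. -/
lemma exists_finset_disjoint [Finite Y] {B : Set C(X, Y)}
    (hB : ∀ C, IsCompact C → IsClosed (B ∩ C)) (f : C(X, Y)) (n : ℕ) (G : Set X)
    (hG : Disjoint {g : C(X, Y) | EqOn g f (U n ∪ G)} B) :
    ∃ t : Finset X, ↑t ⊆ U n ∧ Disjoint {g : C(X, Y) | EqOn g f (U (n + 1) ∪ (G ∪ t))} B := by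
  classical
  have hC := hU.isCompact_setOf_eqOn f (n + 1)
  have hBC : IsCompact (B ∩ {g : C(X, Y) | EqOn g f (U (n + 1))} ∩
      ⋂ x ∈ G, {g : C(X, Y) | g x = f x}) :=
    (hC.of_isClosed_subset (hB _ hC) inter_subset_right).inter_right
      (isClosed_biInter fun x _ => isClosed_setOf_apply_eq x _)
  obtain ⟨t, ht⟩ := hBC.elim_finite_subfamily_closed
    (fun x : U n => {g : C(X, Y) | g x = f x}) (fun x => isClosed_setOf_apply_eq _ _) (by
      refine eq_empty_iff_forall_notMem.2 fun g hg => ?_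
      obtain ⟨⟨⟨hgB, -⟩, hgG⟩, hgU⟩ := hg
      refine disjoint_left.1 hG ?_ hgB
      rintro x (hx | hx)
      · exact mem_iInter.1 hgU ⟨x, hx⟩
      · exact mem_iInter₂.1 hgG x hx)
  refine ⟨t.image Subtype.val, by simp, disjoint_left.2 fun g hg hgB => ?_⟩
  refine eq_empty_iff_forall_notMem.1 ht g ⟨⟨⟨hgB, fun x hx => hg (Or.inl hx)⟩,
    mem_iInter₂.2 fun x hx => hg (Or.inr (Or.inl hx))⟩, mem_iInter₂.2 fun x hx => ?_⟩
  exact hg (Or.inr (Or.inr (Finset.mem_coe.2 (Finset.mem_image_of_mem _ hx))))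

/-- Let `B` have closed intersection with every compact set, and let `f ∉ B`. Starting from `{f}`,
the functions that agree with `f` on `U 0`, the tube lemma yields finitely many points in each `U n`
such that for every `n` no function agreeing with `f` on `U n` and at these points is in `B`. The
points and the derived set form a compact set, and a function that agrees with `f` there agrees with
`f` on some `U n`, so it is not in `B`. -/
lemma compactlyCoherentSpace [T2Space Y] [Finite Y] (hc : IsCompact (derivedSet (univ : Set X))) :
    CompactlyCoherentSpace C(X, Y) := by
  refine .of_isClosed_inter fun B hB => isOpen_compl_iff.1 (isOpen_iff_mem_nhds.2 fun f hf => ?_)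
  choose t htU htB using hU.exists_finset_disjoint hB f
  let S : (n : ℕ) → {G : Set X // Disjoint {g : C(X, Y) | EqOn g f (U n ∪ G)} B} := fun n =>
    Nat.rec ⟨∅, disjoint_left.2 fun g hg => by
      have : g = f := ContinuousMap.ext fun x => hg (Or.inl (hU.zero ▸ mem_univ x))
      exact this ▸ hf⟩ (fun n G => ⟨G.1 ∪ t n G.1 G.2, htB n G.1 G.2⟩) n
  have hS : ∀ n, (S (n + 1)).1 = (S n).1 ∪ t n (S n).1 (S n).2 := fun n => rfl
  have hK : IsCompact (derivedSet univ ∪ ⋃ n, (t n (S n).1 (S n).2 : Set X)) :=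
    hU.isCompact_union hc (fun n => Finset.finite_toSet _) fun n => htU n _ _
  have hSK : ∀ n, (S n).1 ⊆ ⋃ n, (t n (S n).1 (S n).2 : Set X) := by
    intro n
    induction n with
    | zero => exact empty_subset _
    | succ n ih =>
      rw [hS]
      exact union_subset ih (subset_iUnion (fun n => (t n (S n).1 (S n).2 : Set X)) n)
  refine mem_of_superset ((isOpen_setOf_eqOn f hK).mem_nhds fun x _ => rfl) fun g hg hgB => ?_
  obtain ⟨n, hn⟩ := hU.exists_eqOn (hg.mono subset_union_left)
  refine disjoint_left.1 (S n).2 ?_ hgB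
  rintro x (hx | hx)
  · exact hn hx
  · exact hg (Or.inr (hSK n hx))

end Topological

end IsDerivedFiltration

/-! ### The subgroup of functions vanishing on the non-isolated points -/

lemma BoxDirectSum.ext {G : ℕ → Type u} [∀ n, AddCommGroup (G n)] {g h : BoxDirectSum G}
    (hgh : ∀ n, g.coord n = h.coord n) : g = h :=
  DFinsupp.ext hgh

lemma BoxDirectSum.coord_add {G : ℕ → Type u} [∀ n, AddCommGroup (G n)] (g h : BoxDirectSum G)
    (n : ℕ) : (g + h).coord n = g.coord n + h.coord n :=
  DFinsupp.add_apply g h n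

lemma BoxDirectSum.exists_forall_coord_eq_zero {G : ℕ → Type u} [∀ n, AddCommGroup (G n)]
    (g : BoxDirectSum G) : ∃ N, ∀ n ≥ N, g.coord n = 0 := by
  classical
  obtain ⟨N, hN⟩ := (DFinsupp.finite_support (show Π₀ n, G n from g)).bddAbove
  refine ⟨N + 1, fun n hn => by_contra fun h => ?_⟩
  have := hN h
  omega

lemma BoxDirectSum.exists_coord_eq {G : ℕ → Type u} [∀ n, AddCommGroup (G n)] (g : ∀ n, G n)
    {N : ℕ} (hg : ∀ n ≥ N, g n = 0) : ∃ h : BoxDirectSum G, ∀ n, h.coord n = g n :=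
  ⟨(⟨g, Trunc.mk ⟨Multiset.range N, fun n => by
    rw [Multiset.mem_range]
    exact (lt_or_ge n N).imp_right (hg n)⟩⟩ : Π₀ n, G n), fun _ => rfl⟩

/-- The functions in `C(X, 2)` that vanish at all non-isolated points. -/
def derivedVanishing (X : Type u) [TopologicalSpace X] : AddSubgroup C(X, ZMod 2) where
  carrier := {f | EqOn f 0 (derivedSet univ)}
  zero_mem' := fun _ _ => rfl
  add_mem' := fun {f g} hf hg x hx => by
    have h1 : f x = 0 := hf hx
    have h2 : g x = 0 := hg hx
    simp [h1, h2]
  neg_mem' := fun {f} hf x hx => by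
    have h1 : f x = 0 := hf hx
    simp [h1]

/-- A function vanishing on the non-isolated points vanishes on some `U n`, hence is the finite sum
of its restrictions to the layers `U n \ U (n + 1)`. A compact set meets each layer in a finite
set, and conversely finite subsets of the layers together with the non-isolated points form a
compact set; so the compact-open topology is the box topology. -/
lemma IsDerivedFiltration.hasOpenBoxSumSubgroup {X : Type u} [TopologicalSpace X] [T1Space X]
    {U : ℕ → Set X} (hU : IsDerivedFiltration U) (hc : IsCompact (derivedSet (univ : Set X))) :
    HasOpenBoxSumSubgroup C(X, ZMod 2) := by
  classical
  let D : ℕ → Set X := fun n => U n \ U (n + 1)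
  let κ : ℕ → Cardinal.{u} := fun n => Cardinal.mk (D n)
  let e : ∀ n, (κ n).out ≃ D n := fun n => Cardinal.outMkEquiv
  let H := derivedVanishing X
  have hvan : ∀ f : H, ∃ N, ∀ n ≥ N, (fun i : (κ n).out => f.1 (e n i)) = 0 := by
    intro f
    obtain ⟨N, hN⟩ := hU.exists_eqOn (g := (0 : C(X, ZMod 2))) f.2
    exact ⟨N, fun n hn => funext fun i => hN (hU.antitone hn (e n i).2.1)⟩
  choose Φ hΦ using fun f : H => BoxDirectSum.exists_coord_eq
    (G := fun n => (κ n).out → ZMod 2) (fun n i => f.1 (e n i)) (hvan f).choose_spec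
  have hΦadd : ∀ f g, Φ (f + g) = Φ f + Φ g := by
    intro f g
    refine BoxDirectSum.ext fun n => ?_
    rw [BoxDirectSum.coord_add, hΦ, hΦ, hΦ]
    rfl
  let φ : H →+ BoxDirectSum fun n => (κ n).out → ZMod 2 := AddMonoidHom.mk' Φ hΦadd
  have hφ : ∀ f n (x : X) (hx : x ∈ D n), (φ f).coord n ((e n).symm ⟨x, hx⟩) = f.1 x :=
    fun f n x hx => (congrFun (hΦ f n) _).trans
      (congrArg (fun y : D n => f.1 y) ((e n).apply_symm_apply ⟨x, hx⟩))
  have hinj : Function.Injective φ := by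
    intro f g hfg
    refine Subtype.ext (ContinuousMap.ext fun x => ?_)
    by_cases hx : x ∈ derivedSet (univ : Set X)
    · exact (f.2 hx).trans (g.2 hx).symm
    · obtain ⟨n, hn⟩ := hU.exists_mem_diff hx
      rw [← hφ f n x hn, hfg, hφ]
  have hsurj : Function.Surjective φ := by
    intro g
    let h : X → ZMod 2 := fun x =>
      if hx : ∃ n, x ∈ D n then g.coord hx.choose ((e _).symm ⟨x, hx.choose_spec⟩) else 0
    have hh : ∀ n (i : (κ n).out), h (e n i) = g.coord n i := by
      intro n i
      have hx : ∃ m, (e n i : X) ∈ D m := ⟨n, (e n i).2⟩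
      have hn : hx.choose = n := hU.eq_of_mem_diff hx.choose_spec (e n i).2
      have key : ∀ (m : ℕ) (hm : (e n i : X) ∈ D m), m = n →
          g.coord m ((e m).symm ⟨e n i, hm⟩) = g.coord n i := by
        rintro m hm rfl
        simp
      exact (dif_pos hx).trans (key _ hx.choose_spec hn)
    obtain ⟨N, hN⟩ := g.exists_forall_coord_eq_zero
    have hhN : EqOn h (0 : C(X, ZMod 2)) (U N) := by
      intro x hx
      by_cases hxn : ∃ n, x ∈ D n
      · obtain ⟨n, hn⟩ := hxn
        have hNn : N ≤ n := by
          by_contra hlt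
          exact hn.2 (hU.antitone (by omega) hx)
        have := hh n ((e n).symm ⟨x, hn⟩)
        rw [Equiv.apply_symm_apply] at this
        rw [this, hN n hNn]
        rfl
      · exact dif_neg hxn
    refine ⟨⟨⟨h, hU.continuous_of_eqOn hhN⟩, hhN.mono (hU.derivedSet_subset N)⟩, ?_⟩
    refine BoxDirectSum.ext fun n => (hΦ _ n).trans (funext fun i => hh n i)
  have hcont : Continuous φ := by
    refine continuous_generateFrom_iff.2 ?_
    rintro _ ⟨V, hV, rfl⟩
    refine isOpen_iff_mem_nhds.2 fun f hf => ?_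
    choose I u hu huV using fun n => isOpen_pi_iff.1 (hV n) _ (hf n)
    have hK : IsCompact (derivedSet univ ∪ ⋃ n, (fun i => (e n i : X)) '' I n) :=
      hU.isCompact_union hc (fun n => (I n).finite_toSet.image _) fun n => by
        rintro _ ⟨i, -, rfl⟩
        exact (e n i).2.1
    have hopen := (isOpen_setOf_eqOn f.1 hK).preimage (continuous_subtype_val (p := (· ∈ H)))
    refine mem_of_superset (hopen.mem_nhds fun x _ => rfl) fun g hg n => huV n fun i hi => ?_
    have h1 : (φ g).coord n i = (φ f).coord n i := by
      change (Φ g).coord n i = (Φ f).coord n i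
      rw [hΦ, hΦ]
      exact hg (Or.inr (mem_iUnion.2 ⟨n, i, hi, rfl⟩))
    rw [h1]
    exact (hu n i hi).2
  have hopen : IsOpenMap φ := by
    refine isOpenMap_iff_nhds_le.2 fun f s hs => ?_
    obtain ⟨K, hK, hKs⟩ := (((hasBasis_nhds_eqOn f.1).comap Subtype.val).mem_iff.1
      (by rw [← nhds_subtype_eq_comap]; exact hs) :)
    let V : ∀ n, Set ((κ n).out → ZMod 2) :=
      fun n => {h | ∀ i ∈ {i | (e n i : X) ∈ K}, h i = f.1 (e n i)}
    have hV : ∀ n, IsOpen (V n) := by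
      intro n
      have hfin : {i | (e n i : X) ∈ K}.Finite := by
        refine Set.Finite.preimage (f := fun i => (e n i : X))
          (Subtype.val_injective.comp (e n).injective).injOn
          (hU.finite_diff_of_isCompact hK (n + 1)) |>.subset ?_
        exact fun i hi => ⟨hi, (e n i).2.2⟩
      have heq : V n = ⋂ i ∈ {i | (e n i : X) ∈ K},
          {h : (κ n).out → ZMod 2 | h i = f.1 (e n i)} := by
        ext h
        simp [V]
      rw [heq]
      exact hfin.isOpen_biInter fun i _ =>
        (isOpen_discrete {f.1 (e n i)}).preimage
          (show Continuous fun h : (κ n).out → ZMod 2 => h i from continuous_apply i)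
    have hbox : IsOpen {g : BoxDirectSum fun n => (κ n).out → ZMod 2 | ∀ n, g.coord n ∈ V n} :=
      isOpen_generateFrom_of_mem ⟨V, hV, rfl⟩
    refine mem_of_superset (hbox.mem_nhds fun n i _ => ?_) fun g hg => ?_
    · exact congrFun (hΦ f n) i
    · obtain ⟨f', rfl⟩ := hsurj g
      refine hKs fun x hx => ?_
      by_cases hxX : x ∈ derivedSet (univ : Set X)
      · exact (f'.2 hxX).trans (f.2 hxX).symm
      · obtain ⟨n, hn⟩ := hU.exists_mem_diff hxX
        have := hg n ((e n).symm ⟨x, hn⟩) (by simpa using hx)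
        rwa [hφ, Equiv.apply_symm_apply] at this
  refine ⟨H, κ, isOpen_setOf_eqOn 0 hc, fun n => ?_, ⟨.ofBijective φ ⟨hinj, hsurj⟩ hcont hopen⟩⟩
  exact Cardinal.mk_ne_zero_iff.2 (hU.nonempty_diff n).to_subtype

theorem theorem3p4 (X : Type u) [MetricSpace X] (hX : IsZeroDimensional X) :
    (CompactlyCoherentSpace C(X, ZMod 2) ↔
      (IsSumSeparableLocallyCompactDiscrete X ∨
        (¬ LocallyCompactSpace X ∧ IsCompact (derivedSet (univ : Set X))))) ∧
    (IsSumSeparableLocallyCompactDiscrete X → IsPolishTimesCompact C(X, ZMod 2)) ∧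
    (¬ LocallyCompactSpace X ∧ IsCompact (derivedSet (univ : Set X)) →
      HasOpenBoxSumSubgroup C(X, ZMod 2)) := by
  refine ⟨⟨fun _ => ?_, ?_⟩, fun h => h.isPolishTimesCompact, fun ⟨hnlc, hc⟩ => ?_⟩
  · by_cases hlc : LocallyCompactSpace X
    · exact Or.inl (isSumSeparableLocallyCompactDiscrete_of_isSeparable hX
        (isSeparable_derivedSet_of_compactlyCoherentSpace hX))
    · exact Or.inr ⟨hlc, isCompact_derivedSet_of_compactlyCoherentSpace hX hlc⟩
  · rintro (h | ⟨hnlc, hc⟩)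
    · exact h.isPolishTimesCompact.compactlyCoherentSpace
    · obtain ⟨U, hU⟩ := exists_isDerivedFiltration hX hnlc hc
      exact hU.compactlyCoherentSpace hc
  · obtain ⟨U, hU⟩ := exists_isDerivedFiltration hX hnlc hc
    exact hU.hasOpenBoxSumSubgroup hc
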